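/- Conventions. Distributions over $\{0,1\}^n$ are probability vectors indexed by $\{0,1\}^n$. Let $d_H(X,Y)=\frac1n|\{i: X_i\neq Y_i\}|$, and let the Earth Mover Distance $d_{EM}(D_1,D_2)$ be the minimum of $\sum_{X,Y} f_{XY}\,d_H(X,Y)$ over all $f$ with $0\le f_{XY}\le 1$, $\sum_Y f_{XY}=D_1(X)$ for every $X$ and $\sum_X f_{XY}=D_2(Y)$ for every $Y$. A property over $\{0,1\}^n$ is a topologically closed set $\mathcal P$ of distributions over $\{0,1\}^n$. It is index-invariant if $D\in\mathcal P\iff D_\sigma\in\mathcal P$ for every distribution $D$ over $\{0,1\}^n$ and every permutation $\sigma$ of $[n]$, where $D_\sigma(w_{\sigma(1)},\dots,w_{\sigma(n)})=D(w_1,\dots,w_n)$. A distribution $D$ is $\varepsilon$-far from $\mathcal P$ if $\min_{D'\in\mathcal P}d_{EM}(D,D')>\varepsilon$ (every $D$ is $\varepsilon$-far from the empty property). An algorithm with sample and query access to $D$ tosses random coins, draws independent samples $V_1,\dots,V_s$ from $D$, and then adaptively queries single bits of the samples (it names $i\in[s]$ and $j\in[n]$ and receives the $j$-th bit of $V_i$);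 it accepts or rejects depending only on the coins and the answers. The number of queries is counted in the worst case. Corollary. There is a function $q:\mathbb N\times(0,1)\to\mathbb N$ such that the following holds for all $d,n\in\mathbb N$ and every index-invariant property $\mathcal P$ over $\{0,1\}^n$ all of whose members have support of VC-dimension at most $d$. There is an algorithm with sample and query access to an unknown distribution $D$ over $\{0,1\}^n$ which, for every parameter $\varepsilon\in(0,1)$, makes at most $q(d,\varepsilon)$ queries, accepts with probability at least $2/3$ if $D\in\mathcal P$, and rejects with probability at least $2/3$ if $D$ is $\varepsilon$-far from $\mathcal P$. -/

import Mathlib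

noncomputable section

namespace HugeObject

/-- The Hamming cube `{0,1}^n`. -/
abbrev Cube (n : ℕ) : Type := Fin n → Bool

/-- Probability distributions over `{0,1}^n`: nonnegative real weights with sum `1`, with the
topology inherited from the space of all weight functions. -/
abbrev Distribution (n : ℕ) : Type := stdSimplex ℝ (Cube n)

/-- The normalized Hamming distance. -/
def hammingDistance {n : ℕ} (x y : Cube n) : ℝ := (hammingDist x y : ℝ) / n

/-- Feasible transport plans (flows) from `D₁` to `D₂`. -/
def flows {n : ℕ} (D₁ D₂ : Distribution n) : Set (Cube n → Cube n → ℝ) :=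
  {f | (∀ x, ∑ y, f x y = D₁ x) ∧ (∀ y, ∑ x, f x y = D₂ y) ∧ ∀ x y, 0 ≤ f x y ∧ f x y ≤ 1}

/-- The cost of a flow. -/
def flowCost {n : ℕ} (f : Cube n → Cube n → ℝ) : ℝ :=
  ∑ x, ∑ y, f x y * hammingDistance x y

/-- The Earth Mover Distance: the value of the transport linear program. The set of feasible
flows is nonempty and the costs are nonnegative. -/
def emd {n : ℕ} (D₁ D₂ : Distribution n) : ℝ := sInf (flowCost '' flows D₁ D₂)

/-- The Earth Mover Distance of `D` from the property `P`; it is `∞` if `P` is empty. -/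
def distToProperty {n : ℕ} (D : Distribution n) (P : Set (Distribution n)) : ENNReal :=
  ⨅ D' ∈ P, ENNReal.ofReal (emd D D')

/-- `D` is `ε`-far from `P`: the distance of `D` from `P` is more than `ε`. -/
def IsFar {n : ℕ} (ε : ℝ) (D : Distribution n) (P : Set (Distribution n)) : Prop :=
  ENNReal.ofReal ε < distToProperty D P

/-- The distribution `D_σ`, characterized by
`D (w 1, …, w n) = D_σ (w (σ 1), …, w (σ n))`, see `permute_apply_comp`. -/
def permute {n : ℕ} (σ : Equiv.Perm (Fin n)) (D : Distribution n) : Distribution n :=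
  ⟨fun u => D (u ∘ σ.symm), fun _ => D.2.1 _,
    (Equiv.sum_comp (σ.arrowCongr (Equiv.refl Bool)) (fun w : Cube n => D w)).trans D.2.2⟩

theorem permute_apply_comp {n : ℕ} (σ : Equiv.Perm (Fin n)) (D : Distribution n) (w : Cube n) :
    permute σ D (fun i => w (σ i)) = D w := by
  show D (fun i => w (σ (σ.symm i))) = D w
  simp

/-- Index-invariance of a property: membership is unaffected by permuting the indices. -/
def IndexInvariant {n : ℕ} (P : Set (Distribution n)) : Prop :=
  ∀ (D : Distribution n) (σ : Equiv.Perm (Fin n)), D ∈ P ↔ permute σ D ∈ P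

/-- The support of `D`, as a family of subsets of the index set: a vector `w` is identified with
`{i | w i = 1}`. -/
def supportFamily {n : ℕ} (D : Distribution n) : Finset (Finset (Fin n)) :=
  (Finset.univ.filter fun w : Cube n => D w ≠ 0).image
    fun w => Finset.univ.filter fun i => w i = true

/-- Every distribution in `P` has support of VC-dimension at most `d`. -/
def VCDimAtMost {n : ℕ} (d : ℕ) (P : Set (Distribution n)) : Prop :=
  ∀ D ∈ P, (supportFamily D).vcDim ≤ d

/-- Deterministic adaptive query strategies on `s` sampled vectors in `{0,1}^n`: either stop with
a verdict (`true` is accept, `false` is reject), or query the `j`-th bit of the `i`-th sample and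
continue according to the answer. -/
inductive QueryTree (s n : ℕ) : Type
  | verdict (b : Bool) : QueryTree s n
  | query (i : Fin s) (j : Fin n) (next : Bool → QueryTree s n) : QueryTree s n

/-- The verdict reached when the sampled vectors are `V 0, …, V (s - 1)`. -/
def QueryTree.run {s n : ℕ} (V : Fin s → Cube n) : QueryTree s n → Bool
  | .verdict b => b
  | .query i j next => (next (V i j)).run V

/-- The worst-case number of queries of a query strategy. -/
def QueryTree.depth {s n : ℕ} : QueryTree s n → ℕ
  | .verdict _ => 0
  | .query _ _ next => max (next false).depth (next true).depth + 1

/-- An (adaptive) randomized algorithm with sample and query access to a distribution over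
`{0,1}^n`: it tosses coins, draws `samples` vectors, and runs a query strategy that depends on the
outcome of the coins. -/
structure Algorithm (n : ℕ) where
  /-- the number of sampled vectors -/
  samples : ℕ
  /-- the possible outcomes of the coins -/
  Coins : Type
  [fintypeCoins : Fintype Coins]
  /-- the law of the coins -/
  coinLaw : stdSimplex ℝ Coins
  /-- the query strategy chosen by the coins -/
  strategy : Coins → QueryTree samples n

attribute [instance] Algorithm.fintypeCoins

/-- The number of queries in the worst case over coins and samples. -/
def Algorithm.queryComplexity {n : ℕ} (A : Algorithm n) : ℕ :=
  Finset.univ.sup fun c => (A.strategy c).depth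

/-- The probability that `A` gives the verdict `b` when the sampled vectors are independent with
law `D` and independent of the coins. -/
def Algorithm.prob {n : ℕ} (A : Algorithm n) (D : Distribution n) (b : Bool) : ℝ :=
  ∑ c, A.coinLaw c *
    ∑ V : Fin A.samples → Cube n, if (A.strategy c).run V = b then ∏ i, D (V i) else 0

/-- `A` `ε`-tests `P` (with probability at least `2/3`). -/
def Algorithm.Tests {n : ℕ} (A : Algorithm n) (ε : ℝ) (P : Set (Distribution n)) : Prop :=
  (∀ D ∈ P, 2 / 3 ≤ A.prob D true) ∧ ∀ D, IsFar ε D P → 2 / 3 ≤ A.prob D false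

end HugeObject

end

noncomputable section

namespace HugeObject

open Finset

/-! ### Finite probability spaces -/

/-! A distribution whose support is covered by few small balls is essentially determined by a
bounded sample. Split the sample into centers `V` and further vectors `W`. Most mass lies near some
center, so `W` records how much mass each center attracts, and the uniform law on `W` is close to
`D` in Earth Mover Distance (`Represents.close`). Bounded VC-dimension supplies the covering: a
packing is separated by few random columns, where the Sauer–Shelah bound limits its size
(`exists_packing_bound`), and a maximal packing is a covering (`exists_covering_bound`).

The sampled vectors are too long to read. However, the matrix with these rows has boundedly many
possible column patterns, and a few random columns reveal their frequencies
(`pr_not_representative_le`). Two matrices with similar pattern frequencies agree, up to a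
permutation of columns, outside a small fraction of columns (`Representative.exists_perm`).
Index-invariance makes this permutation harmless.

The tester therefore reads all sampled vectors in a few random columns and accepts iff a typical
sample of some member of `P`, read in typical columns, could give the same answers. Members are
accepted because they are typical with good probability. If a distribution is accepted although its
own sample is typical, `Acceptable.exists_close` places it near a permuted member of `P`. All
typicality statements come from Chebyshev, Markov and union bounds. -/

/-- The total weight of an event. -/
def pr {Ω : Type*} [Fintype Ω] (w : Ω → ℝ) (S : Set Ω) : ℝ := ∑ x, S.indicator w x

/-- The product weight of independent samples. -/
def iid {Ω : Type*} (p : Ω → ℝ) (N : ℕ) (V : Fin N → Ω) : ℝ := ∏ i, p (V i)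

section Pr

variable {Ω α β : Type*} [Fintype Ω] [Fintype α] [Fintype β]

theorem pr_mono {w : Ω → ℝ} (hw : ∀ x, 0 ≤ w x) {S T : Set Ω} (h : S ⊆ T) : pr w S ≤ pr w T :=
  sum_le_sum fun x _ => Set.indicator_le_indicator_of_subset h hw x

theorem pr_union_le {w : Ω → ℝ} (hw : ∀ x, 0 ≤ w x) (S T : Set Ω) :
    pr w (S ∪ T) ≤ pr w S + pr w T := by
  classical
  unfold pr
  rw [← sum_add_distrib]
  refine sum_le_sum fun x _ => ?_
  have := hw x
  by_cases h1 : x ∈ S <;> by_cases h2 : x ∈ T <;> (simp [Set.indicator, h1, h2]; try linarith)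

theorem pr_iUnion_le {ι : Type*} [Fintype ι] {w : Ω → ℝ} (hw : ∀ x, 0 ≤ w x) (S : ι → Set Ω) :
    pr w (⋃ i, S i) ≤ ∑ i, pr w (S i) := by
  classical
  unfold pr
  rw [sum_comm]
  refine sum_le_sum fun x _ => ?_
  have h0 : ∀ i ∈ univ, 0 ≤ (S i).indicator w x := fun i _ => Set.indicator_nonneg (fun y _ => hw y) x
  by_cases h : x ∈ ⋃ i, S i
  · obtain ⟨i, hi⟩ := Set.mem_iUnion.1 h
    rw [Set.indicator_of_mem h]
    calc w x = (S i).indicator w x := (Set.indicator_of_mem hi _).symm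
      _ ≤ _ := single_le_sum h0 (mem_univ i)
  · rw [Set.indicator_of_notMem h]
    exact sum_nonneg h0

theorem pr_add_compl {w : Ω → ℝ} (hw : ∑ x, w x = 1) (S : Set Ω) : pr w S + pr w Sᶜ = 1 := by
  unfold pr
  rw [← sum_add_distrib, ← hw]
  exact sum_congr rfl fun x _ => Set.indicator_self_add_compl_apply S w x

/-- Markov's inequality. -/
theorem pr_lt_le {w : Ω → ℝ} (hw : ∀ x, 0 ≤ w x) {F : Ω → ℝ} (hF : ∀ x, 0 ≤ F x) {a : ℝ}
    (ha : 0 < a) : pr w {x | a < F x} ≤ (∑ x, w x * F x) / a := by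
  unfold pr
  rw [le_div_iff₀ ha, sum_mul]
  refine sum_le_sum fun x _ => ?_
  by_cases h : a < F x
  · rw [Set.indicator_of_mem (by exact h)]
    exact mul_le_mul_of_nonneg_left h.le (hw x)
  · rw [Set.indicator_of_notMem (by exact h), zero_mul]
    exact mul_nonneg (hw x) (hF x)

/-- Conditioning on one independent coordinate: a bound uniform in the fixed coordinate survives
averaging over it. -/
theorem pr_prod_le_of_left {w : α → ℝ} {w' : β → ℝ} (hw : w ∈ stdSimplex ℝ α)
    (S : Set (α × β)) {c : ℝ} (h : ∀ a, pr w' {b | (a, b) ∈ S} ≤ c) :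
    pr (fun x : α × β => w x.1 * w' x.2) S ≤ c := by
  classical
  unfold pr
  rw [Fintype.sum_prod_type]
  calc _ = ∑ a, w a * pr w' {b | (a, b) ∈ S} := by
        refine sum_congr rfl fun a _ => ?_
        unfold pr
        rw [mul_sum]
        refine sum_congr rfl fun b _ => ?_
        simp [Set.indicator]
    _ ≤ ∑ a, w a * c := sum_le_sum fun a _ => mul_le_mul_of_nonneg_left (h a) (hw.1 a)
    _ = c := by rw [← sum_mul, hw.2, one_mul]

theorem pr_prod_swap {w : α → ℝ} {w' : β → ℝ} (S : Set (α × β)) :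
    pr (fun x : α × β => w x.1 * w' x.2) S =
      pr (fun x : β × α => w' x.1 * w x.2) (Prod.swap ⁻¹' S) := by
  unfold pr
  refine Fintype.sum_equiv (Equiv.prodComm α β) _ _ fun x => ?_
  by_cases h : x ∈ S
  · rw [Set.indicator_of_mem h, Set.indicator_of_mem (show Equiv.prodComm α β x ∈ _ from h), mul_comm]
    rfl
  · rw [Set.indicator_of_notMem h, Set.indicator_of_notMem (show Equiv.prodComm α β x ∉ _ from h)]

theorem pr_prod_le_of_right {w : α → ℝ} {w' : β → ℝ} (hw' : w' ∈ stdSimplex ℝ β)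
    (S : Set (α × β)) {c : ℝ} (h : ∀ b, pr w {a | (a, b) ∈ S} ≤ c) :
    pr (fun x : α × β => w x.1 * w' x.2) S ≤ c := by
  rw [pr_prod_swap]
  exact pr_prod_le_of_left hw' _ h

end Pr

section Iid

theorem iid_nonneg {Ω : Type*} {p : Ω → ℝ} (hp : ∀ x, 0 ≤ p x) (N : ℕ) (V : Fin N → Ω) : 0 ≤ iid p N V :=
  prod_nonneg fun _ _ => hp _

theorem iid_cons {Ω : Type*} {p : Ω → ℝ} (x : Ω) (N : ℕ) (V : Fin N → Ω) :
    iid p (N + 1) (Fin.cons x V) = p x * iid p N V := by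
  simp [iid, Fin.prod_univ_succ]

variable {Ω : Type*} [Fintype Ω] {p : Ω → ℝ}

theorem sum_iid_mul_prod (p : Ω → ℝ) (N : ℕ) (f : Ω → ℝ) :
    ∑ V, iid p N V * ∏ i, f (V i) = (∑ x, p x * f x) ^ N := by
  classical
  simp_rw [iid, ← prod_mul_distrib]
  rw [← Fintype.piFinset_univ, ← prod_univ_sum (fun _ : Fin N => (univ : Finset Ω)) (fun _ x => p x * f x)]
  simp

theorem iid_mem (hp : p ∈ stdSimplex ℝ Ω) (N : ℕ) : iid p N ∈ stdSimplex ℝ (Fin N → Ω) := by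
  refine ⟨iid_nonneg hp.1 N, ?_⟩
  have := sum_iid_mul_prod p N (fun _ => 1)
  simpa [hp.2] using this

theorem sum_succ_fun (N : ℕ) (F : (Fin (N + 1) → Ω) → ℝ) :
    ∑ V, F V = ∑ x, ∑ V : Fin N → Ω, F (Fin.cons x V) := by
  rw [← Fintype.sum_prod_type' (f := fun x V => F (Fin.cons x V))]
  exact (Fintype.sum_equiv (Fin.consEquiv fun _ : Fin (N + 1) => Ω) _ _ fun x => rfl).symm

theorem sum_iid_mul_sum (hp : p ∈ stdSimplex ℝ Ω) (N : ℕ) (f : Ω → ℝ) :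
    ∑ V, iid p N V * ∑ i, f (V i) = N * ∑ x, p x * f x := by
  induction N with
  | zero => simp
  | succ N ih =>
    rw [sum_succ_fun]
    simp_rw [iid_cons, Fin.sum_univ_succ, Fin.cons_zero, Fin.cons_succ]
    have h : ∀ x, ∑ V, p x * iid p N V * (f x + ∑ i, f (V i)) =
        p x * f x + p x * (N * ∑ x, p x * f x) := fun x => by
      rw [← ih, mul_sum]
      have : p x * f x = ∑ V, p x * iid p N V * f x := by
        rw [← sum_mul, ← mul_sum, (iid_mem hp N).2, mul_one]
      rw [this, ← sum_add_distrib]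
      exact sum_congr rfl fun V _ => by ring
    simp_rw [h]
    rw [sum_add_distrib, ← sum_mul, hp.2]
    push_cast
    ring

/-- Cross terms of independent centred variables vanish, so second moments add up. -/
theorem sum_iid_mul_sq (hp : p ∈ stdSimplex ℝ Ω) (N : ℕ) {f : Ω → ℝ} (hf : ∑ x, p x * f x = 0) :
    ∑ V, iid p N V * (∑ i, f (V i)) ^ 2 = N * ∑ x, p x * f x ^ 2 := by
  induction N with
  | zero => simp
  | succ N ih =>
    rw [sum_succ_fun]
    simp_rw [iid_cons, Fin.sum_univ_succ, Fin.cons_zero, Fin.cons_succ]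
    have h0 : ∑ V, iid p N V * ∑ i, f (V i) = 0 := by rw [sum_iid_mul_sum hp, hf, mul_zero]
    have h : ∀ x, ∑ V, p x * iid p N V * (f x + ∑ i, f (V i)) ^ 2 =
        p x * f x ^ 2 + p x * (N * ∑ x, p x * f x ^ 2) := fun x => by
      calc _ = ∑ V, (p x * f x ^ 2 * iid p N V + 2 * p x * f x * (iid p N V * ∑ i, f (V i))
            + p x * (iid p N V * (∑ i, f (V i)) ^ 2)) :=
            sum_congr rfl fun V _ => by ring
        _ = _ := by
          rw [sum_add_distrib, sum_add_distrib, ← mul_sum, ← mul_sum, ← mul_sum, h0, ih,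
            (iid_mem hp N).2]
          ring
    simp_rw [h]
    rw [sum_add_distrib, ← sum_mul, hp.2]
    push_cast
    ring

/-- Chebyshev's inequality for the empirical mean of a function with values in `[0,1]`. -/
theorem pr_empirical_le (hp : p ∈ stdSimplex ℝ Ω) {N : ℕ} (hN : 0 < N) {f : Ω → ℝ}
    (hf : ∀ x, 0 ≤ f x ∧ f x ≤ 1) {δ : ℝ} (hδ : 0 < δ) :
    pr (iid p N) {V | δ < |(∑ i, f (V i)) / N - ∑ x, p x * f x|} ≤ 1 / (N * δ ^ 2) := by
  have hN' : (0 : ℝ) < N := by exact_mod_cast hN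
  set μ := ∑ x, p x * f x with hμ
  have hμ0 : 0 ≤ μ := sum_nonneg fun x _ => mul_nonneg (hp.1 x) (hf x).1
  have hμ1 : μ ≤ 1 := by
    rw [← hp.2]
    exact sum_le_sum fun x _ => mul_le_of_le_one_right (hp.1 x) (hf x).2
  have hc : ∑ x, p x * (f x - μ) = 0 := by
    simp_rw [mul_sub]
    rw [sum_sub_distrib, ← sum_mul, hp.2, ← hμ]
    ring
  have hv : ∑ x, p x * (f x - μ) ^ 2 ≤ 1 := by
    rw [← hp.2]
    refine sum_le_sum fun x _ => mul_le_of_le_one_right (hp.1 x) ?_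
    have := hf x
    rw [sq_le_one_iff_abs_le_one, abs_le]
    constructor <;> linarith [this.1, this.2]
  have key := pr_lt_le (w := iid p N) (iid_nonneg hp.1 N) (F := fun V => (∑ i, (f (V i) - μ)) ^ 2)
    (fun V => sq_nonneg _) (a := (N * δ) ^ 2) (by positivity)
  rw [sum_iid_mul_sq hp N hc] at key
  refine le_trans (pr_mono (iid_nonneg hp.1 N) ?_) (key.trans ?_)
  · intro V hV
    simp only [Set.mem_ofPred_eq] at hV ⊢
    rw [sum_sub_distrib, sum_const, card_univ, Fintype.card_fin, nsmul_eq_mul]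
    have e : (∑ i, f (V i)) / N - μ = ((∑ i, f (V i)) - N * μ) / N := by field_simp
    rw [e, abs_div, abs_of_pos hN', lt_div_iff₀ hN'] at hV
    rw [← sq_abs (_ - _)]
    exact pow_lt_pow_left₀ (by linarith [mul_comm δ (N : ℝ)]) (by positivity) two_ne_zero
  · calc _ ≤ (N * 1) / (N * δ) ^ 2 := by gcongr
      _ = _ := by field_simp

theorem pr_exists_empirical_le {ι : Type*} [Fintype ι] (hp : p ∈ stdSimplex ℝ Ω) {N : ℕ}
    (hN : 0 < N) {f : ι → Ω → ℝ} (hf : ∀ i x, 0 ≤ f i x ∧ f i x ≤ 1) {δ : ℝ} (hδ : 0 < δ) :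
    pr (iid p N) {V | ∃ i, δ < |(∑ l, f i (V l)) / N - ∑ x, p x * f i x|} ≤
      Fintype.card ι / (N * δ ^ 2) := by
  have := pr_iUnion_le (iid_nonneg hp.1 N)
    fun i : ι => {V | δ < |(∑ l, f i (V l)) / N - ∑ x, p x * f i x|}
  rw [← Set.ofPred_exists] at this
  refine this.trans ((sum_le_sum fun i _ => pr_empirical_le hp hN (hf i) hδ).trans ?_)
  rw [sum_const, card_univ, nsmul_eq_mul, mul_one_div]

/-- The two blocks of one sample are independent; this allows the centers to be fixed before the
remaining vectors are drawn. -/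
theorem pr_iid_append (p : Ω → ℝ) (k s : ℕ) (S : Set ((Fin k → Ω) × (Fin s → Ω))) :
    pr (iid p (k + s)) {X | (fun i => X (Fin.castAdd s i), fun i => X (Fin.natAdd k i)) ∈ S} =
      pr (fun x : (Fin k → Ω) × (Fin s → Ω) => iid p k x.1 * iid p s x.2) S := by
  classical
  unfold pr
  refine (Fintype.sum_equiv (Fin.appendEquiv k s) _ _ fun x => ?_).symm
  simp [Set.indicator, iid, Fin.prod_univ_add, Fin.appendEquiv]

end Iid

/-! ### The Earth Mover Distance -/

section Hamming

variable {n : ℕ}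

theorem hammingDistance_nonneg (x y : Cube n) : 0 ≤ hammingDistance x y := by
  unfold hammingDistance
  positivity

theorem hammingDistance_le_one (x y : Cube n) : hammingDistance x y ≤ 1 := by
  unfold hammingDistance
  refine div_le_one_of_le₀ ?_ (Nat.cast_nonneg _)
  have := hammingDist_le_card_fintype (x := x) (y := y)
  rw [Fintype.card_fin] at this
  exact_mod_cast this

theorem hammingDistance_self (x : Cube n) : hammingDistance x x = 0 := by
  simp [hammingDistance]

theorem hammingDistance_comm (x y : Cube n) : hammingDistance x y = hammingDistance y x := by
  simp [hammingDistance, hammingDist_comm]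

theorem hammingDistance_triangle (x y z : Cube n) :
    hammingDistance x z ≤ hammingDistance x y + hammingDistance y z := by
  unfold hammingDistance
  rw [← add_div]
  gcongr
  exact_mod_cast hammingDist_triangle x y z

theorem hammingDistance_comp (σ : Equiv.Perm (Fin n)) (x y : Cube n) :
    hammingDistance (x ∘ σ) (y ∘ σ) = hammingDistance x y := by
  unfold hammingDistance hammingDist
  congr 2
  refine card_bij (fun i _ => σ i) ?_ ?_ ?_
  · simp
  · simp
  · intro b hb
    exact ⟨σ.symm b, by simpa using hb, by simp⟩

end Hamming

section Close

variable {n : ℕ}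

/-- There is a transport plan from `D₁` to `D₂` of cost at most `c`. -/
def Close (D₁ D₂ : Distribution n) (c : ℝ) : Prop :=
  ∃ f : Cube n → Cube n → ℝ, (∀ x y, 0 ≤ f x y) ∧ (∀ x, ∑ y, f x y = D₁ x) ∧
    (∀ y, ∑ x, f x y = D₂ y) ∧ flowCost f ≤ c

theorem weight_le_one (D : Distribution n) (x : Cube n) : D x ≤ 1 := by
  rw [← D.2.2]
  exact single_le_sum (f := fun x => D x) (fun y _ => D.2.1 y) (mem_univ x)

theorem Close.emd_le {D₁ D₂ : Distribution n} {c : ℝ} (h : Close D₁ D₂ c) : emd D₁ D₂ ≤ c := by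
  obtain ⟨f, h0, h1, h2, h3⟩ := h
  refine le_trans (csInf_le ⟨0, ?_⟩ ⟨f, ⟨h1, h2, fun x y => ⟨h0 x y, ?_⟩⟩, rfl⟩) h3
  · rintro _ ⟨g, hg, rfl⟩
    exact sum_nonneg fun x _ => sum_nonneg fun y _ =>
      mul_nonneg (hg.2.2 x y).1 (hammingDistance_nonneg x y)
  -- The upper bound on flow entries is automatic, which is why `Close` omits it.
  · calc f x y ≤ ∑ y, f x y := single_le_sum (fun y _ => h0 x y) (mem_univ y)
      _ = D₁ x := h1 x
      _ ≤ 1 := weight_le_one D₁ x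

theorem Close.mono {D₁ D₂ : Distribution n} {c c' : ℝ} (h : Close D₁ D₂ c) (hc : c ≤ c') :
    Close D₁ D₂ c' := by
  obtain ⟨f, h0, h1, h2, h3⟩ := h
  exact ⟨f, h0, h1, h2, h3.trans hc⟩

theorem Close.symm {D₁ D₂ : Distribution n} {c : ℝ} (h : Close D₁ D₂ c) : Close D₂ D₁ c := by
  obtain ⟨f, h0, h1, h2, h3⟩ := h
  refine ⟨fun x y => f y x, fun x y => h0 y x, h2, h1, le_trans (le_of_eq ?_) h3⟩
  unfold flowCost
  rw [sum_comm]
  simp_rw [hammingDistance_comm]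

/-- Glue the plans along `D₂`, making the endpoints conditionally independent given the middle
point. Where `D₂` vanishes both plans vanish, so the convention for division by zero is harmless. -/
theorem Close.trans {D₁ D₂ D₃ : Distribution n} {c c' : ℝ} (h : Close D₁ D₂ c)
    (h' : Close D₂ D₃ c') : Close D₁ D₃ (c + c') := by
  obtain ⟨f, f0, f1, f2, f3⟩ := h
  obtain ⟨g, g0, g1, g2, g3⟩ := h'
  have hf : ∀ x y, D₂ y = 0 → f x y = 0 := fun x y hy =>
    (sum_eq_zero_iff_of_nonneg fun x _ => f0 x y).1 ((f2 y).trans hy) x (mem_univ x)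
  have hg : ∀ y z, D₂ y = 0 → g y z = 0 := fun y z hy =>
    (sum_eq_zero_iff_of_nonneg fun z _ => g0 y z).1 ((g1 y).trans hy) z (mem_univ z)
  have hl : ∀ x y, ∑ z, f x y * g y z / D₂ y = f x y := fun x y => by
    rw [← sum_div, ← mul_sum, g1]
    by_cases hy : D₂ y = 0
    · simp [hf x y hy]
    · field_simp
  have hr : ∀ y z, ∑ x, f x y * g y z / D₂ y = g y z := fun y z => by
    rw [← sum_div, ← sum_mul, f2]
    by_cases hy : D₂ y = 0
    · simp [hg y z hy]
    · field_simp
  have h0 : ∀ x y z, 0 ≤ f x y * g y z / D₂ y := fun x y z =>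
    div_nonneg (mul_nonneg (f0 x y) (g0 y z)) (D₂.2.1 y)
  refine ⟨fun x z => ∑ y, f x y * g y z / D₂ y, fun x z => sum_nonneg fun y _ => h0 x y z,
    fun x => ?_, fun z => ?_, le_trans ?_ (add_le_add f3 g3)⟩
  · rw [sum_comm]
    simp_rw [hl, f1]
  · rw [sum_comm]
    simp_rw [hr, g2]
  · have e1 : flowCost f = ∑ x, ∑ z, ∑ y, f x y * g y z / D₂ y * hammingDistance x y := by
      refine sum_congr rfl fun x _ => ?_
      rw [sum_comm]
      simp_rw [← sum_mul, hl]
    have e2 : flowCost g = ∑ x, ∑ z, ∑ y, f x y * g y z / D₂ y * hammingDistance y z := by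
      rw [sum_comm]
      simp_rw [fun z => sum_comm (s := univ) (t := univ)
        (f := fun x y => f x y * g y z / D₂ y * hammingDistance y z), ← sum_mul, hr]
      rw [sum_comm]
      rfl
    rw [e1, e2, ← sum_add_distrib]
    refine sum_le_sum fun x _ => ?_
    rw [← sum_add_distrib]
    refine sum_le_sum fun z _ => ?_
    rw [← sum_add_distrib, sum_mul]
    refine sum_le_sum fun y _ => ?_
    rw [← mul_add]
    exact mul_le_mul_of_nonneg_left (hammingDistance_triangle x y z) (h0 x y z)

theorem Close.permute {D₁ D₂ : Distribution n} {c : ℝ} (h : Close D₁ D₂ c)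
    (σ : Equiv.Perm (Fin n)) : Close (permute σ D₁) (permute σ D₂) c := by
  obtain ⟨f, h0, h1, h2, h3⟩ := h
  have key : ∀ F : Cube n → ℝ, ∑ u : Cube n, F (u ∘ σ.symm) = ∑ w, F w := fun F =>
    Equiv.sum_comp (σ.arrowCongr (Equiv.refl Bool)) F
  refine ⟨fun x y => f (x ∘ σ.symm) (y ∘ σ.symm), fun x y => h0 _ _, fun x => ?_, fun y => ?_,
    le_trans (le_of_eq ?_) h3⟩
  · exact (key fun y => f (x ∘ σ.symm) y).trans (h1 _)
  · exact (key fun x => f x (y ∘ σ.symm)).trans (h2 _)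
  · unfold flowCost
    rw [← key fun x => ∑ y, f x y * hammingDistance x y]
    refine sum_congr rfl fun x _ => ?_
    rw [← key fun y => f (x ∘ σ.symm) y * hammingDistance (x ∘ σ.symm) y]
    refine sum_congr rfl fun y _ => ?_
    rw [hammingDistance_comp]

/-- Distributions that are close in total variation are close in the Earth Mover Distance. -/
theorem close_of_totalVariation (D₁ D₂ : Distribution n) : Close D₁ D₂ (∑ x, |D₁ x - D₂ x|) := by
  classical
  set a : Cube n → ℝ := fun x => max (D₁ x - D₂ x) 0 with ha
  set b : Cube n → ℝ := fun x => max (D₂ x - D₁ x) 0 with hb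
  set δ := ∑ x, a x with hδ
  have a0 : ∀ x, 0 ≤ a x := fun x => le_max_right _ _
  have b0 : ∀ x, 0 ≤ b x := fun x => le_max_right _ _
  have am : ∀ x, min (D₁ x) (D₂ x) + a x = D₁ x := fun x => by
    rcases le_total (D₁ x) (D₂ x) with h | h <;> simp [ha, h]
  have bm : ∀ x, min (D₁ x) (D₂ x) + b x = D₂ x := fun x => by
    rcases le_total (D₁ x) (D₂ x) with h | h <;> simp [hb, h]
  have hδb : ∑ x, b x = δ := by
    have h1 := D₁.2.2
    have h2 := D₂.2.2
    have e1 : ∑ x, min (D₁ x) (D₂ x) + δ = 1 := by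
      rw [hδ, ← sum_add_distrib, ← h1]
      exact sum_congr rfl fun x _ => am x
    have e2 : ∑ x, min (D₁ x) (D₂ x) + ∑ x, b x = 1 := by
      rw [← sum_add_distrib, ← h2]
      exact sum_congr rfl fun x _ => bm x
    linarith
  have δ0 : 0 ≤ δ := sum_nonneg fun x _ => a0 x
  have az : δ = 0 → ∀ x, a x = 0 := fun h x =>
    (sum_eq_zero_iff_of_nonneg fun x _ => a0 x).1 h x (mem_univ x)
  have bz : δ = 0 → ∀ x, b x = 0 := fun h x =>
    (sum_eq_zero_iff_of_nonneg fun x _ => b0 x).1 (hδb.trans h) x (mem_univ x)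
  have sa : ∀ x, ∑ y, a x * b y / δ = a x := fun x => by
    rw [← sum_div, ← mul_sum, hδb]
    by_cases h : δ = 0
    · simp [az h x]
    · field_simp
  have sb : ∀ y, ∑ x, a x * b y / δ = b y := fun y => by
    rw [← sum_div, ← sum_mul, ← hδ]
    by_cases h : δ = 0
    · simp [bz h y]
    · field_simp
  have ab0 : ∀ x y, 0 ≤ a x * b y / δ := fun x y => div_nonneg (mul_nonneg (a0 x) (b0 y)) δ0
  -- The common mass stays in place; the excess `a` is spread over the deficits `b` by the
  -- normalized product plan, at distance at most `1`.
  refine ⟨fun x y => (if x = y then min (D₁ x) (D₂ x) else 0) + a x * b y / δ,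
    fun x y => ?_, fun x => ?_, fun y => ?_, ?_⟩
  · refine add_nonneg ?_ (ab0 x y)
    split_ifs
    · exact le_min (D₁.2.1 x) (D₂.2.1 x)
    · exact le_rfl
  · rw [sum_add_distrib, sa]
    simpa using am x
  · rw [sum_add_distrib, sb]
    simpa using bm y
  · calc _ ≤ ∑ x, ∑ y, a x * b y / δ := by
          refine sum_le_sum fun x _ => sum_le_sum fun y _ => ?_
          by_cases h : x = y
          · subst h
            rw [hammingDistance_self, mul_zero]
            exact ab0 x x
          · simp only [h, if_false, zero_add]
            exact mul_le_of_le_one_right (ab0 x y) (hammingDistance_le_one x y)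
      _ = ∑ x, a x := sum_congr rfl fun x _ => sa x
      _ ≤ _ := sum_le_sum fun x _ => max_le (le_abs_self _) (abs_nonneg _)

/-- The law of a random vector `X` on a finite probability space with weights `p`. -/
def law {ι : Type*} [Fintype ι] (p : stdSimplex ℝ ι) (X : ι → Cube n) : Distribution n :=
  ⟨fun x => ∑ i, if X i = x then p i else 0,
    fun _ => sum_nonneg fun i _ => by split_ifs; exacts [p.2.1 i, le_rfl], by
    rw [sum_comm]
    simp⟩

theorem law_apply {ι : Type*} [Fintype ι] (p : stdSimplex ℝ ι) (X : ι → Cube n) (x : Cube n) :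
    law p X x = ∑ i, if X i = x then p i else 0 := rfl

theorem law_id (D : Distribution n) : law D id = D := by
  ext x
  rw [law_apply]
  simp

theorem permute_law {ι : Type*} [Fintype ι] (p : stdSimplex ℝ ι) (X : ι → Cube n)
    (σ : Equiv.Perm (Fin n)) : permute σ (law p X) = law p fun i => X i ∘ σ := by
  ext x
  change law p X (x ∘ σ.symm) = _
  rw [law_apply, law_apply]
  refine sum_congr rfl fun i _ => ?_
  congr 1
  rw [eq_iff_iff, Equiv.eq_comp_symm]

/-- The coupling that draws a single `i` and outputs both `X i` and `Y i` has exactly this cost. -/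
theorem close_law {ι : Type*} [Fintype ι] (p : stdSimplex ℝ ι) (X Y : ι → Cube n) :
    Close (law p X) (law p Y) (∑ i, p i * hammingDistance (X i) (Y i)) := by
  refine ⟨fun x y => ∑ i, if X i = x then if Y i = y then p i else 0 else 0, fun x y =>
    sum_nonneg fun i _ => by split_ifs; exacts [p.2.1 i, le_rfl, le_rfl],
    fun x => ?_, fun y => ?_, le_of_eq ?_⟩
  · rw [sum_comm, law_apply]
    refine sum_congr rfl fun i _ => ?_
    split_ifs <;> simp
  · rw [sum_comm, law_apply]
    refine sum_congr rfl fun i _ => ?_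
    simp
  · unfold flowCost
    simp_rw [sum_mul, ite_mul, zero_mul]
    simp_rw [fun x => sum_comm (s := (univ : Finset (Cube n))) (t := (univ : Finset ι))
      (f := fun y i => if X i = x then if Y i = y then p i * hammingDistance x y else 0 else 0)]
    rw [sum_comm]
    refine sum_congr rfl fun i _ => ?_
    rw [sum_eq_single (X i)]
    · simp
    · intro x _ hx
      simp [hx.symm]
    · simp

theorem close_law_of_weights {ι : Type*} [Fintype ι] (p q : stdSimplex ℝ ι) (X : ι → Cube n) :
    Close (law p X) (law q X) (∑ i, |p i - q i|) := by
  refine (close_of_totalVariation _ _).mono ?_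
  calc _ ≤ ∑ x, ∑ i, if X i = x then |p i - q i| else 0 := by
        refine sum_le_sum fun x _ => ?_
        rw [law_apply, law_apply, ← sum_sub_distrib]
        refine (abs_sum_le_sum_abs _ _).trans (sum_le_sum fun i _ => ?_)
        split_ifs <;> simp
    _ = _ := by
        rw [sum_comm]
        simp

/-- The push-forward of a finite probability vector. -/
def push {ι κ : Type*} [Fintype ι] [Fintype κ] [DecidableEq κ] (p : stdSimplex ℝ ι) (π : ι → κ) :
    stdSimplex ℝ κ :=
  ⟨fun k => ∑ i, if π i = k then p i else 0,
    fun _ => sum_nonneg fun i _ => by split_ifs; exacts [p.2.1 i, le_rfl], by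
    rw [sum_comm]
    simp⟩

theorem push_apply {ι κ : Type*} [Fintype ι] [Fintype κ] [DecidableEq κ] (p : stdSimplex ℝ ι)
    (π : ι → κ) (k : κ) : push p π k = ∑ i, if π i = k then p i else 0 := rfl

theorem law_push {ι κ : Type*} [Fintype ι] [Fintype κ] [DecidableEq κ] (p : stdSimplex ℝ ι)
    (π : ι → κ) (V : κ → Cube n) : law (push p π) V = law p (V ∘ π) := by
  ext x
  rw [law_apply, law_apply]
  simp_rw [push_apply, ← sum_filter]
  rw [sum_comm' (t' := univ.filter fun i => V (π i) = x) (s' := fun i => {π i})]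
  · simp
  · intro k i
    simp only [mem_filter, mem_univ, true_and, mem_singleton]
    constructor
    · rintro ⟨h1, h2⟩
      exact ⟨h2.symm, by rw [h2, h1]⟩
    · rintro ⟨rfl, h⟩
      exact ⟨h, rfl⟩

end Close

/-! ### Packings and coverings of families of bounded VC-dimension -/

/-- The uniform weights on the indices. -/
def unif (n : ℕ) (_ : Fin n) : ℝ := 1 / n

theorem unif_mem {n : ℕ} (hn : 0 < n) : unif n ∈ stdSimplex ℝ (Fin n) := by
  refine ⟨fun _ => by unfold unif; positivity, ?_⟩
  have : (n : ℝ) ≠ 0 := by positivity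
  simp [unif, this]

/-- The set of indices of the ones of a vector. -/
def ones {n : ℕ} (w : Cube n) : Finset (Fin n) := univ.filter fun i => w i = true

theorem mem_ones {n : ℕ} {w : Cube n} {i : Fin n} : i ∈ ones w ↔ w i = true := by
  simp [ones]

theorem sum_unif_agree {n : ℕ} (hn : 0 < n) (x y : Cube n) :
    ∑ j, unif n j * (if x j = y j then 1 else 0) = 1 - hammingDistance x y := by
  have hn' : (n : ℝ) ≠ 0 := by positivity
  unfold unif hammingDistance hammingDist
  rw [← mul_sum, sum_boole]
  have h := card_filter_add_card_filter_not (s := (univ : Finset (Fin n))) fun i => x i = y i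
  rw [card_univ, Fintype.card_fin] at h
  have h' : (#{i | x i = y i} : ℝ) + #{i | ¬ x i = y i} = n := by exact_mod_cast h
  field_simp
  linarith

theorem pr_agree {n : ℕ} (hn : 0 < n) (t : ℕ) (x y : Cube n) :
    pr (iid (unif n) t) {J | ∀ a, x (J a) = y (J a)} = (1 - hammingDistance x y) ^ t := by
  classical
  rw [← sum_unif_agree hn, ← sum_iid_mul_prod]
  refine sum_congr rfl fun J _ => ?_
  by_cases h : ∀ a, x (J a) = y (J a)
  · rw [Set.indicator_of_mem (by exact h), prod_eq_one (fun a _ => by simp [h a]), mul_one]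
  · rw [Set.indicator_of_notMem (by exact h)]
    obtain ⟨a, ha⟩ := not_forall.1 h
    rw [prod_eq_zero (mem_univ a) (by simp [ha]), mul_zero]

/-- A packing is separated by few random columns. -/
theorem exists_columns {n : ℕ} (hn : 0 < n) {t : ℕ} {ζ : ℝ} (S : Finset (Cube n))
    (hS : ∀ x ∈ S, ∀ y ∈ S, x ≠ y → ζ < hammingDistance x y)
    (h : (#S : ℝ) ^ 2 * (1 - ζ) ^ t < 1) :
    ∃ J : Fin t → Fin n, ∀ x ∈ S, ∀ y ∈ S, (∀ a, x (J a) = y (J a)) → x = y := by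
  classical
  by_contra! hJ
  have hp := iid_mem (unif_mem hn) t
  have hu := pr_iUnion_le hp.1
    fun q : S.offDiag => {J : Fin t → Fin n | ∀ a, q.1.1 (J a) = q.1.2 (J a)}
  have huniv : (⋃ q : S.offDiag, {J : Fin t → Fin n | ∀ a, q.1.1 (J a) = q.1.2 (J a)}) =
      Set.univ := by
    refine Set.eq_univ_of_forall fun J => ?_
    obtain ⟨x, hx, y, hy, hxy, hne⟩ := hJ J
    exact Set.mem_iUnion.2 ⟨⟨(x, y), mem_offDiag.2 ⟨hx, hy, hne⟩⟩, hxy⟩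
  have hone : pr (iid (unif n) t) Set.univ = 1 := by
    unfold pr
    simpa using hp.2
  rw [huniv, hone] at hu
  have hle : ∀ q : S.offDiag,
      pr (iid (unif n) t) {J | ∀ a, q.1.1 (J a) = q.1.2 (J a)} ≤ (1 - ζ) ^ t := fun q => by
    rw [pr_agree hn]
    obtain ⟨h1, h2, h3⟩ := mem_offDiag.1 q.2
    have := hS _ h1 _ h2 h3
    exact pow_le_pow_left₀ (by linarith [hammingDistance_le_one q.1.1 q.1.2]) (by linarith) t
  -- An arbitrary choice of columns already produces two distinct points of `S`; their distance
  -- exceeds `ζ` and is at most `1`, which gives the sign of `1 - ζ`.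
  obtain ⟨x, hx, y, hy, -, hne⟩ := hJ fun _ => ⟨0, hn⟩
  have hζ : 0 ≤ 1 - ζ := by linarith [hS x hx y hy hne, hammingDistance_le_one x y]
  have := hu.trans (sum_le_sum fun q _ => hle q)
  rw [sum_const, card_univ, Fintype.card_coe, nsmul_eq_mul] at this
  have hc : ((#S.offDiag : ℕ) : ℝ) ≤ (#S : ℝ) ^ 2 := by
    rw [offDiag_card, sq]
    exact_mod_cast Nat.sub_le _ _
  have := mul_le_mul_of_nonneg_right hc (pow_nonneg hζ t)
  linarith

/-- Separation makes the trace on the chosen columns injective on `S`. The trace family has at most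
as many members as shattered sets, and these are subsets of the chosen columns of size at most `d`.
-/
theorem card_le_of_columns {n t d : ℕ} (ht : 0 < t) (S : Finset (Cube n))
    (hd : (S.image ones).vcDim ≤ d) (J : Fin t → Fin n)
    (hJ : ∀ x ∈ S, ∀ y ∈ S, (∀ a, x (J a) = y (J a)) → x = y) : #S ≤ (d + 1) * t ^ d := by
  classical
  set T : Finset (Fin n) := univ.image J with hT
  set 𝒜 : Finset (Finset (Fin n)) := S.image fun x => ones x ∩ T with h𝒜
  have hcard : #𝒜 = #S := by
    refine card_image_of_injOn fun x hx y hy hxy => hJ x hx y hy fun a => ?_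
    have ha : J a ∈ T := mem_image_of_mem _ (mem_univ a)
    have := Finset.ext_iff.1 hxy (J a)
    simp only [mem_inter, ha, and_true, mem_ones] at this
    exact Bool.eq_iff_iff.2 this
  have hTc : #T ≤ t := card_image_le.trans (by simp)
  have hsub : 𝒜.shatterer ⊆ (range (d + 1)).biUnion fun k => T.powersetCard k := by
    intro s hs
    have hs := mem_shatterer.1 hs
    have hsT : s ⊆ T := by
      obtain ⟨u, hu, hsu⟩ := hs.exists_superset
      obtain ⟨x, -, rfl⟩ := mem_image.1 hu
      exact hsu.trans inter_subset_right
    have hs' : (S.image ones).Shatters s := by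
      intro r hr
      obtain ⟨u, hu, hsu⟩ := hs hr
      obtain ⟨x, hx, rfl⟩ := mem_image.1 hu
      refine ⟨ones x, mem_image_of_mem _ hx, ?_⟩
      rw [← hsu, ← inter_assoc, inter_right_comm, inter_eq_left.2 hsT]
    refine mem_biUnion.2 ⟨#s, mem_range.2 ?_, mem_powersetCard.2 ⟨hsT, rfl⟩⟩
    exact Nat.lt_succ_of_le (hs'.card_le_vcDim.trans hd)
  calc #S = #𝒜 := hcard.symm
    _ ≤ #𝒜.shatterer := card_le_card_shatterer _
    _ ≤ _ := card_le_card hsub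
    _ ≤ ∑ k ∈ range (d + 1), #(T.powersetCard k) := card_biUnion_le
    _ ≤ ∑ k ∈ range (d + 1), t ^ d := by
        refine sum_le_sum fun k hk => ?_
        rw [card_powersetCard]
        calc (#T).choose k ≤ #T ^ k := Nat.choose_le_pow _ _
          _ ≤ t ^ k := Nat.pow_le_pow_left hTc k
          _ ≤ t ^ d := Nat.pow_le_pow_right ht (Nat.le_of_lt_succ (mem_range.1 hk))
    _ = _ := by simp

theorem exists_large_pow {d : ℕ} {ζ : ℝ} (h0 : 0 < ζ) (h1 : ζ < 1) :
    ∃ t : ℕ, 0 < t ∧ (((d + 1) * t ^ d + 1 : ℕ) : ℝ) ^ 2 * (1 - ζ) ^ t < 1 := by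
  -- Exponential decay beats the polynomial; for positive `t` the base of the square is at most `(d
  -- + 2) * t ^ d`.
  have hlim := (tendsto_pow_const_mul_const_pow_of_lt_one (2 * d) (r := 1 - ζ) (by linarith)
    (by linarith)).const_mul (((d : ℝ) + 2) ^ 2)
  rw [mul_zero] at hlim
  obtain ⟨t, ht, ht0⟩ := ((hlim.eventually (gt_mem_nhds zero_lt_one)).and
    (Filter.eventually_gt_atTop 0)).exists
  refine ⟨t, ht0, lt_of_le_of_lt ?_ ht⟩
  rw [← mul_assoc]
  refine mul_le_mul_of_nonneg_right ?_ (pow_nonneg (by linarith) t)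
  rw [pow_mul', ← mul_pow]
  have ht1 : (1 : ℝ) ≤ (t : ℝ) ^ d := one_le_pow₀ (by exact_mod_cast ht0)
  push_cast
  refine pow_le_pow_left₀ (by positivity) (by linarith) 2

/-- Families of bounded VC-dimension have packing numbers independent of the dimension. -/
theorem exists_packing_bound (d : ℕ) {ζ : ℝ} (h0 : 0 < ζ) (h1 : ζ < 1) :
    ∃ K : ℕ, ∀ (n : ℕ) (S : Finset (Cube n)), (S.image ones).vcDim ≤ d →
      (∀ x ∈ S, ∀ y ∈ S, x ≠ y → ζ < hammingDistance x y) → #S ≤ K := by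
  classical
  obtain ⟨t, ht, hlt⟩ := exists_large_pow (d := d) h0 h1
  refine ⟨(d + 1) * t ^ d, fun n S hd hS => ?_⟩
  by_contra! hlarge
  -- Trim the packing to one point more than the bound, the size for which `t` was chosen.
  obtain ⟨S', hS', hcard⟩ := exists_subset_card_eq (Nat.succ_le_of_lt hlarge)
  rcases Nat.eq_zero_or_pos n with rfl | hn
  · have h2 : #S' ≤ 1 := card_le_one_of_subsingleton S'
    have : 0 < (d + 1) * t ^ d := by positivity
    omega
  · have hsep : ∀ x ∈ S', ∀ y ∈ S', x ≠ y → ζ < hammingDistance x y :=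
      fun x hx y hy => hS x (hS' hx) y (hS' hy)
    obtain ⟨J, hJ⟩ := exists_columns hn S' hsep (by rw [hcard]; exact hlt)
    have := card_le_of_columns ht S' ((vcDim_mono (image_subset_image hS')).trans hd) J hJ
    omega

/-- The support of a distribution of bounded VC-dimension is covered by few balls. -/
theorem exists_covering_bound (d : ℕ) {ζ : ℝ} (h0 : 0 < ζ) (h1 : ζ < 1) :
    ∃ K : ℕ, ∀ (n : ℕ) (D : Distribution n), (supportFamily D).vcDim ≤ d →
      ∃ S : Finset (Cube n), #S ≤ K ∧ ∀ x, D x ≠ 0 → ∃ y ∈ S, hammingDistance x y ≤ ζ := by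
  classical
  obtain ⟨K, hK⟩ := exists_packing_bound d h0 h1
  refine ⟨K, fun n D hD => ?_⟩
  set supp : Finset (Cube n) := univ.filter fun w : Cube n => D w ≠ 0 with hsupp
  have hfam : supp.image ones = supportFamily D := rfl
  -- A packing of maximal size covers the support, since an uncovered point could be added to it.
  obtain ⟨S, hS, hmax⟩ := exists_max_image
    (supp.powerset.filter fun S => ∀ x ∈ S, ∀ y ∈ S, x ≠ y → ζ < hammingDistance x y) card
    ⟨∅, by simp⟩
  obtain ⟨hsub, hsep⟩ := mem_filter.1 hS
  rw [mem_powerset] at hsub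
  refine ⟨S, hK n S ((vcDim_mono (image_subset_image hsub)).trans (hfam ▸ hD)) hsep, ?_⟩
  intro x hx
  by_contra! hfar
  have hxS : x ∉ S := fun h => absurd (hfar x h) (by rw [hammingDistance_self]; linarith)
  have hins : insert x S ∈
      supp.powerset.filter fun S => ∀ x ∈ S, ∀ y ∈ S, x ≠ y → ζ < hammingDistance x y := by
    refine mem_filter.2 ⟨mem_powerset.2 (insert_subset (by simp [hsupp, hx]) hsub), ?_⟩
    intro y hy z hz hyz
    rcases mem_insert.1 hy with hy' | hy' <;> rcases mem_insert.1 hz with hz' | hz'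
    · exact absurd (hy'.trans hz'.symm) hyz
    · exact hy' ▸ hfar z hz'
    · rw [hammingDistance_comm]
      exact hz' ▸ hfar y hy'
    · exact hsep y hy' z hz' hyz
  have := hmax _ hins
  rw [card_insert_of_notMem hxS] at this
  omega

/-! ### Matching columns by their patterns -/

theorem card_filter_eq_of_perm {n : ℕ} {C : Type*} [DecidableEq C] (c : Fin n → C)
    (σ : Equiv.Perm (Fin n)) (v : C) : #{j | c (σ j) = v} = #{j | c j = v} := by
  refine card_bij (fun i _ => σ i) (by simp) (by simp) fun b hb => ?_
  exact ⟨σ.symm b, by simpa using hb, by simp⟩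

/-- Two colourings of a finite set with similar class sizes mostly agree up to a permutation. -/
theorem exists_perm_card_ne_le {n : ℕ} {C : Type*} [Fintype C] [DecidableEq C] (c c' : Fin n → C) :
    ∃ σ : Equiv.Perm (Fin n),
      (#{j | c j ≠ c' (σ j)} : ℝ) ≤ ∑ v, |(#{j | c j = v} : ℝ) - #{j | c' j = v}| := by
  obtain ⟨σ, -, hσ⟩ := exists_min_image (univ : Finset (Equiv.Perm (Fin n)))
    (fun σ => #{j | c j ≠ c' (σ j)}) univ_nonempty
  refine ⟨σ, ?_⟩
  -- Otherwise exchanging the images of two mismatched positions would repair `j` and break nothing,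
  -- against the minimality of `σ`.
  have key : ∀ j j', c j ≠ c' (σ j) → c j' ≠ c' (σ j') → c j ≠ c' (σ j') := by
    intro j j' hj hj' h
    have hne : j ≠ j' := by
      rintro rfl
      exact hj h
    refine absurd (hσ (Equiv.swap j j' |>.trans σ) (mem_univ _)) (not_le.2 ?_)
    refine card_lt_card ⟨fun i hi => ?_, fun hs => ?_⟩
    · replace hi := (mem_filter.1 hi).2
      refine mem_filter.2 ⟨mem_univ _, ?_⟩
      by_cases h1 : i = j
      · subst h1
        exact hj
      by_cases h2 : i = j'
      · subst h2
        exact hj'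
      rwa [Equiv.trans_apply, Equiv.swap_apply_of_ne_of_ne h1 h2] at hi
    · refine (mem_filter.1 (hs (mem_filter.2 ⟨mem_univ j, hj⟩))).2 ?_
      rw [Equiv.trans_apply, Equiv.swap_apply_left]
      exact h
  -- If colour `v` has a mismatch, `key` puts the class of `v` under `c' ∘ σ` inside its class under
  -- `c`, so the mismatches are exactly the difference of the two classes.
  have hv : ∀ v, (#{j | c j ≠ c' (σ j) ∧ c j = v} : ℝ) ≤
      |(#{j | c j = v} : ℝ) - #{j | c' j = v}| := by
    intro v
    rw [← card_filter_eq_of_perm c' σ v]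
    by_cases hB : ∃ j, c j ≠ c' (σ j) ∧ c j = v
    · obtain ⟨j, hj, rfl⟩ := hB
      refine le_trans ?_ (le_abs_self _)
      have hsub : ({i | c' (σ i) = c j} : Finset (Fin n)) ⊆ ({i | c i = c j} : Finset _) := by
        intro i hi
        simp only [mem_filter, mem_univ, true_and] at hi ⊢
        by_contra hne
        exact key j i hj (by rw [hi]; exact hne) hi.symm
      have hsd : ({i | c i ≠ c' (σ i) ∧ c i = c j} : Finset (Fin n)) =
          ({i | c i = c j} : Finset (Fin n)) \ ({i | c' (σ i) = c j} : Finset (Fin n)) := by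
        ext i
        simp only [mem_filter, mem_univ, true_and, mem_sdiff]
        constructor
        · rintro ⟨h1, h2⟩
          exact ⟨h2, fun h3 => h1 (h2.trans h3.symm)⟩
        · rintro ⟨h1, h2⟩
          exact ⟨fun h3 => h2 (h3.symm.trans h1), h1⟩
      rw [hsd, card_sdiff_of_subset hsub, Nat.cast_sub (card_le_card hsub)]
    · have : ({j | c j ≠ c' (σ j) ∧ c j = v} : Finset (Fin n)) = ∅ := by
        ext i
        simp only [mem_filter, mem_univ, true_and, notMem_empty, iff_false]
        exact fun h => hB ⟨i, h⟩
      rw [this]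
      simp
  refine le_trans (le_of_eq ?_) (sum_le_sum fun v _ => hv v)
  rw [card_eq_sum_card_fiberwise (f := c) (t := univ) (by simp)]
  push_cast
  refine sum_congr rfl fun v _ => ?_
  rw [filter_filter]

/-! ### Approximation by a sample -/

theorem weights_mem {ι : Type*} [Fintype ι] (D : stdSimplex ℝ ι) : ⇑D ∈ stdSimplex ℝ ι := D.2

theorem sum_weights {ι : Type*} [Fintype ι] (D : stdSimplex ℝ ι) : ∑ x, D x = 1 := D.2.2

section Sample

variable {n k s : ℕ}

/-- The uniform probability vector. -/
def unifVec {s : ℕ} (hs : 0 < s) : stdSimplex ℝ (Fin s) := ⟨unif s, unif_mem hs⟩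

theorem unifVec_apply {s : ℕ} (hs : 0 < s) (l : Fin s) : unifVec hs l = 1 / s := rfl

theorem sum_unifVec_mul {s : ℕ} (hs : 0 < s) (f : Fin s → ℝ) :
    ∑ l, unifVec hs l * f l = (∑ l, f l) / s := by
  simp_rw [unifVec_apply, ← mul_sum]
  ring

/-- The index of an entry of `V` that is nearest to `x`. -/
def nearest (V : Fin (k + 1) → Cube n) (x : Cube n) : Fin (k + 1) :=
  (Finite.exists_min fun i => hammingDistance x (V i)).choose

/-- The distance from `x` to the nearest entry of `V`. -/
def gap (V : Fin (k + 1) → Cube n) (x : Cube n) : ℝ := hammingDistance x (V (nearest V x))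

theorem gap_le (V : Fin (k + 1) → Cube n) (x : Cube n) (i : Fin (k + 1)) :
    gap V x ≤ hammingDistance x (V i) :=
  (Finite.exists_min fun i => hammingDistance x (V i)).choose_spec i

theorem gap_nonneg (V : Fin (k + 1) → Cube n) (x : Cube n) : 0 ≤ gap V x :=
  hammingDistance_nonneg _ _

theorem gap_le_one (V : Fin (k + 1) → Cube n) (x : Cube n) : gap V x ≤ 1 :=
  hammingDistance_le_one _ _

/-- The sample `W` represents `D` as far as the nearest entries of `V` are concerned. -/
def Represents (hs : 0 < s) (η : ℝ) (D : Distribution n) (V : Fin (k + 1) → Cube n)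
    (W : Fin s → Cube n) : Prop :=
  ∑ i, |push D (nearest V) i - push (unifVec hs) (nearest V ∘ W) i| ≤ η ∧
    ∑ x, D x * gap V x ≤ (∑ l, gap V (W l)) / s + η

/-- Move `D` to the nearest centers (cost `L + η`), correct the weights of the centers (`η`), then
move the centers out to `W` (`L`). -/
theorem Represents.close {hs : 0 < s} {η L : ℝ} {D : Distribution n} {V : Fin (k + 1) → Cube n}
    {W : Fin s → Cube n} (h : Represents hs η D V W) (hL : (∑ l, gap V (W l)) / s ≤ L) :
    Close D (law (unifVec hs) W) (2 * L + 2 * η) := by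
  have h1 : Close D (law D (V ∘ nearest V)) (L + η) := by
    have := close_law D id (V ∘ nearest V)
    rw [law_id] at this
    exact this.mono (h.2.trans (by linarith))
  have h2 : Close (law D (V ∘ nearest V)) (law (unifVec hs) (V ∘ nearest V ∘ W)) η := by
    have := close_law_of_weights (push D (nearest V)) (push (unifVec hs) (nearest V ∘ W)) V
    rw [law_push, law_push] at this
    exact this.mono h.1
  have h3 : Close (law (unifVec hs) (V ∘ nearest V ∘ W)) (law (unifVec hs) W) L := by
    refine (close_law _ W (V ∘ nearest V ∘ W)).symm.mono ?_
    rw [sum_unifVec_mul]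
    exact hL
  exact ((h1.trans h2).trans h3).mono (by linarith)

/-- Chebyshev and a union bound over `k + 2` functions: the gap (`none`) and the indicators of the
`k + 1` nearest-center cells. Tolerance `η / (k + 1)` per cell adds up to `η`. -/
theorem pr_not_represents_le (hs : 0 < s) {η : ℝ} (hη : 0 < η) (D : Distribution n)
    (V : Fin (k + 1) → Cube n) :
    pr (iid D s) {W | ¬ Represents hs η D V W} ≤ (k + 2) / (s * (η / (k + 1)) ^ 2) := by
  set f : Option (Fin (k + 1)) → Cube n → ℝ := fun o x =>
    o.elim (gap V x) fun i => if nearest V x = i then 1 else 0 with hf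
  have hf01 : ∀ o x, 0 ≤ f o x ∧ f o x ≤ 1 := by
    rintro (_ | i) x
    · exact ⟨gap_nonneg V x, gap_le_one V x⟩
    · simp only [hf, Option.elim]
      split_ifs <;> simp
  have hδ : 0 < η / (k + 1) := by positivity
  have key := pr_exists_empirical_le (weights_mem D) hs hf01 hδ
  simp only [Fintype.card_option, Fintype.card_fin] at key
  refine (pr_mono (iid_nonneg D.2.1 s) ?_).trans (key.trans (le_of_eq ?_))
  · intro W hW
    by_contra hno
    refine hW ?_
    have hno : ∀ o, |(∑ l, f o (W l)) / s - ∑ x, D x * f o x| ≤ η / (k + 1) := fun o =>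
      not_lt.1 fun ho => hno ⟨o, ho⟩
    refine ⟨?_, ?_⟩
    · calc _ ≤ ∑ i : Fin (k + 1), η / (k + 1) := by
            refine sum_le_sum fun i _ => ?_
            have := hno (some i)
            rw [abs_sub_comm] at this
            refine le_trans (le_of_eq ?_) this
            congr 2
            · rw [push_apply]
              simp [hf]
            · rw [push_apply]
              simp only [hf, Option.elim, unifVec_apply, Function.comp, sum_div]
              refine sum_congr rfl fun l _ => ?_
              split_ifs <;> simp
        _ = η := by
            rw [sum_const, card_univ, Fintype.card_fin, nsmul_eq_mul]
            push_cast
            field_simp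
    · have h1 := (abs_le.1 (hno none)).1
      have h2 : η / (k + 1) ≤ η := div_le_self hη.le (by linarith [(Nat.cast_nonneg k : (0:ℝ) ≤ k)])
      simp only [hf, Option.elim] at h1
      linarith
  · push_cast
    ring

/-- Bernoulli's inequality for `(1 + p) ^ N`, combined with `(1 - p) * (1 + p) ≤ 1`. -/
theorem mul_one_sub_pow_le {p : ℝ} (h0 : 0 ≤ p) (h1 : p ≤ 1) {N : ℕ} (hN : 0 < N) :
    p * (1 - p) ^ N ≤ 1 / N := by
  have hN' : (0 : ℝ) < N := by exact_mod_cast hN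
  have h2 : 1 + N * p ≤ (1 + p) ^ N := one_add_mul_le_pow (by linarith) N
  have h3 : (1 - p) ^ N * (1 + p) ^ N ≤ 1 := by
    rw [← mul_pow]
    exact pow_le_one₀ (mul_nonneg (by linarith) (by linarith)) (by nlinarith)
  have h4 : 0 ≤ (1 - p) ^ N := pow_nonneg (by linarith) N
  rw [le_div_iff₀ hN']
  have := mul_le_mul_of_nonneg_left h2 h4
  nlinarith

/-- The expected mass of the part of the space whose cell is missed by a sample. -/
theorem sum_missed_le (D : Distribution n) (S : Finset (Cube n)) (c : Cube n → Cube n)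
    (hc : ∀ x, D x ≠ 0 → c x ∈ S) {N : ℕ} (hN : 0 < N) :
    ∑ x, D x * ∑ V, iid D N V * ∏ i, (if c (V i) = c x then 0 else 1) ≤ #S / N := by
  have hcompl : ∀ v, ∑ y, D y * (if c y = v then 0 else 1) = 1 - push D c v := fun v => by
    rw [← sum_weights D, push_apply, eq_sub_iff_add_eq, ← sum_add_distrib]
    refine sum_congr rfl fun y _ => ?_
    split_ifs <;> simp
  have h : ∀ x, ∑ V, iid D N V * ∏ i, (if c (V i) = c x then (0 : ℝ) else 1) =
      (1 - push D c (c x)) ^ N := fun x => by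
    rw [sum_iid_mul_prod D N fun y => if c y = c x then 0 else 1, hcompl]
  simp_rw [h]
  -- Group by cells: a cell of mass `p` contributes `p * (1 - p) ^ N`, and only cells labelled by
  -- `S` have mass.
  calc ∑ x, D x * (1 - push D c (c x)) ^ N = ∑ v, push D c v * (1 - push D c v) ^ N := by
        simp_rw [push_apply D c, sum_mul]
        rw [sum_comm]
        refine sum_congr rfl fun x _ => ?_
        simp [ite_mul]
    _ ≤ ∑ v, if v ∈ S then 1 / (N : ℝ) else 0 := by
        refine sum_le_sum fun v _ => ?_
        split_ifs with hv
        · refine mul_one_sub_pow_le ((push D c).2.1 v) ?_ hN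
          rw [← sum_weights (push D c)]
          exact single_le_sum (f := fun v => push D c v) (fun v _ => (push D c).2.1 v) (mem_univ v)
        · have : push D c v = 0 := by
            rw [push_apply]
            refine sum_eq_zero fun x _ => ?_
            split_ifs with hx
            · by_contra h0
              exact hv (hx ▸ hc x h0)
            · rfl
          rw [this, zero_mul]
    _ = #S / N := by
        rw [← sum_filter]
        simp [div_eq_mul_inv]

/-- Assign each support point to a ball. If a center falls in the ball of `x`, the gap is at most `2
* ζ`; otherwise it is at most `1`, and `sum_missed_le` bounds the expected mass of such `x`. -/
theorem sum_iid_gap_le (D : Distribution n) (S : Finset (Cube n)) {ζ : ℝ} (hζ : 0 ≤ ζ)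
    (hS : ∀ x, D x ≠ 0 → ∃ y ∈ S, hammingDistance x y ≤ ζ) :
    ∑ V, iid D (k + 1) V * ∑ x, D x * gap V x ≤ 2 * ζ + #S / (k + 1) := by
  have hc : ∀ x, ∃ y, D x ≠ 0 → y ∈ S ∧ hammingDistance x y ≤ ζ := fun x => by
    by_cases h : D x = 0
    · exact ⟨x, fun h' => absurd h h'⟩
    · obtain ⟨y, hy⟩ := hS x h
      exact ⟨y, fun _ => hy⟩
  choose c hc using hc
  have hgap : ∀ V : Fin (k + 1) → Cube n, ∀ x, D x ≠ 0 → iid D (k + 1) V ≠ 0 →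
      gap V x ≤ 2 * ζ + ∏ i, (if c (V i) = c x then 0 else 1) := by
    intro V x hx hV
    by_cases h : ∃ i, c (V i) = c x
    · obtain ⟨i, hi⟩ := h
      have hVi : D (V i) ≠ 0 := fun h0 => hV (prod_eq_zero (mem_univ i) h0)
      rw [prod_eq_zero (mem_univ i) (by simp [hi]), add_zero]
      have h1 := (hc x hx).2
      have h2 := (hc _ hVi).2
      rw [hi, hammingDistance_comm] at h2
      linarith [gap_le V x i, hammingDistance_triangle x (c x) (V i)]
    · push Not at h
      rw [prod_eq_one fun i _ => by simp [h i]]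
      linarith [gap_le_one V x]
  have hm := sum_missed_le D S c (fun x hx => (hc x hx).1) (Nat.succ_pos k)
  calc _ ≤ ∑ V, iid D (k + 1) V *
        ∑ x, D x * (2 * ζ + ∏ i, (if c (V i) = c x then 0 else 1)) := by
        refine sum_le_sum fun V _ => ?_
        by_cases hV : iid D (k + 1) V = 0
        · simp [hV]
        refine mul_le_mul_of_nonneg_left (sum_le_sum fun x _ => ?_) (iid_nonneg D.2.1 _ V)
        by_cases hx : D x = 0
        · simp [hx]
        exact mul_le_mul_of_nonneg_left (hgap V x hx hV) (D.2.1 x)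
    _ = 2 * ζ + ∑ x, D x * ∑ V, iid D (k + 1) V *
        ∏ i, (if c (V i) = c x then 0 else 1) := by
        simp_rw [mul_add, sum_add_distrib, ← sum_mul, mul_add]
        rw [sum_add_distrib, ← sum_mul, (iid_mem (weights_mem D) (k + 1)).2]
        rw [sum_weights D, one_mul, one_mul]
        congr 1
        simp_rw [mul_sum]
        rw [sum_comm]
        exact sum_congr rfl fun x _ => sum_congr rfl fun V _ => by ring
    _ ≤ _ := by
        push_cast at hm
        linarith

theorem pr_not_sparse_le (hs : 0 < s) (D : Distribution n) (S : Finset (Cube n)) {ζ L : ℝ}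
    (hζ : 0 ≤ ζ) (hL : 0 < L) (hS : ∀ x, D x ≠ 0 → ∃ y ∈ S, hammingDistance x y ≤ ζ) :
    pr (fun x : (Fin (k + 1) → Cube n) × (Fin s → Cube n) => iid D (k + 1) x.1 * iid D s x.2)
      {x | L < (∑ l, gap x.1 (x.2 l)) / s} ≤ (2 * ζ + #S / (k + 1)) / L := by
  have hs' : (s : ℝ) ≠ 0 := by positivity
  refine (pr_lt_le (fun x => mul_nonneg (iid_nonneg D.2.1 _ _) (iid_nonneg D.2.1 _ _))
    (fun x => div_nonneg (sum_nonneg fun l _ => gap_nonneg _ _) (Nat.cast_nonneg s)) hL).trans ?_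
  refine div_le_div_of_nonneg_right (le_trans (le_of_eq ?_) (sum_iid_gap_le D S hζ hS)) hL.le
  rw [Fintype.sum_prod_type]
  refine sum_congr rfl fun V _ => ?_
  have := sum_iid_mul_sum (weights_mem D) s (gap V)
  calc ∑ W, iid D (k + 1) V * iid D s W * ((∑ l, gap V (W l)) / s) =
        iid D (k + 1) V * ((∑ W, iid D s W * ∑ l, gap V (W l)) / s) := by
        rw [sum_div, mul_sum]
        exact sum_congr rfl fun W _ => by ring
    _ = _ := by
        rw [this]
        field_simp

end Sample

/-! ### Sampling columns -/

section Columns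

variable {n m t : ℕ}

/-- The `j`-th column of the matrix with rows `X i`. -/
def column (X : Fin m → Cube n) (j : Fin n) : Cube m := fun i => X i j

/-- The columns chosen by `J` have nearly the same statistics as all columns. -/
def Representative (η : ℝ) (X : Fin m → Cube n) (J : Fin t → Fin n) : Prop :=
  ∑ v, |(#{j | column X j = v} : ℝ) / n - (#{a | column X (J a) = v} : ℝ) / t| ≤ η

theorem pr_not_representative_le (hn : 0 < n) (ht : 0 < t) {η : ℝ} (hη : 0 < η)
    (X : Fin m → Cube n) :
    pr (iid (unif n) t) {J | ¬ Representative η X J} ≤ 2 ^ m / (t * (η / 2 ^ m) ^ 2) := by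
  have hδ : 0 < η / 2 ^ m := by positivity
  have key := pr_exists_empirical_le (unif_mem hn) ht
    (f := fun (v : Cube m) j => if column X j = v then 1 else 0)
    (fun v j => by split_ifs <;> simp) hδ
  have hcard : Fintype.card (Cube m) = 2 ^ m := by simp
  rw [hcard] at key
  push_cast at key
  refine (pr_mono (iid_nonneg (unif_mem hn).1 t) ?_).trans key
  intro J hJ
  by_contra hno
  refine hJ ?_
  have hno : ∀ v, _ := fun v => not_lt.1 fun ho => hno ⟨v, ho⟩
  unfold Representative
  calc _ ≤ ∑ v : Cube m, η / 2 ^ m := by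
        refine sum_le_sum fun v _ => ?_
        have := hno v
        rw [abs_sub_comm, sum_boole] at this
        refine le_trans (le_of_eq ?_) this
        congr 2
        unfold unif
        rw [← mul_sum, sum_boole]
        ring
    _ = η := by
        rw [sum_const, card_univ, hcard, nsmul_eq_mul]
        push_cast
        field_simp

/-- Matrices that agree on representative columns agree up to a permutation of the columns and
few errors. -/
theorem Representative.exists_perm {η : ℝ} {X X' : Fin m → Cube n}
    {J J' : Fin t → Fin n} (h : Representative η X J) (h' : Representative η X' J')
    (hXX' : ∀ i a, X i (J a) = X' i (J' a)) :
    ∃ σ : Equiv.Perm (Fin n), ∀ i, hammingDistance (X i) (X' i ∘ σ) ≤ 2 * η := by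
  obtain ⟨σ, hσ⟩ := exists_perm_card_ne_le (column X) (column X')
  refine ⟨σ, fun i => ?_⟩
  have hη : 0 ≤ η := le_trans (sum_nonneg fun v _ => abs_nonneg _) h
  rcases Nat.eq_zero_or_pos n with rfl | hn
  · have : X i = X' i ∘ σ := Subsingleton.elim _ _
    rw [this, hammingDistance_self]
    linarith
  have hn' : (0 : ℝ) < n := by exact_mod_cast hn
  have hcol : ∀ a, column X (J a) = column X' (J' a) := fun a => funext fun i => hXX' i a
  unfold Representative at h h'
  simp_rw [← hcol] at h'
  have hsum : ∑ v, |(#{j | column X j = v} : ℝ) - #{j | column X' j = v}| ≤ 2 * η * n := by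
    calc _ ≤ ∑ v, n * (|(#{j | column X j = v} : ℝ) / n - (#{a | column X (J a) = v} : ℝ) / t| +
          |(#{j | column X' j = v} : ℝ) / n - (#{a | column X (J a) = v} : ℝ) / t|) := by
          refine sum_le_sum fun v _ => ?_
          rw [abs_sub_comm ((#{j | column X' j = v} : ℝ) / n)]
          refine le_trans (le_of_eq ?_) (mul_le_mul_of_nonneg_left (abs_sub_le _ _ _) hn'.le)
          rw [← sub_div, abs_div, abs_of_pos hn']
          field_simp
      _ ≤ _ := by
          rw [← mul_sum, sum_add_distrib]
          nlinarith
  unfold hammingDistance hammingDist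
  rw [div_le_iff₀ hn']
  refine le_trans ?_ (hσ.trans hsum)
  refine Nat.cast_le.2 (card_le_card fun j hj => ?_)
  simp only [mem_filter, mem_univ, true_and] at hj ⊢
  exact fun h => hj (congrFun h i)

end Columns

/-! ### Comparing two distributions through their samples -/

section Transfer

variable {n k s : ℕ}

/-- Only the primed sample is assumed sparse; the other inherits average gap at most `L + 4 * η`.
The three legs cost `2 * L + 10 * η`, `2 * η` and `2 * L + 2 * η`. -/
theorem close_permute_of_rows {hs : 0 < s} {η L : ℝ} {D D' : Distribution n}
    {V V' : Fin (k + 1) → Cube n} {W W' : Fin s → Cube n} (h : Represents hs η D V W)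
    (h' : Represents hs η D' V' W') (hL : (∑ l, gap V' (W' l)) / s ≤ L)
    (σ : Equiv.Perm (Fin n)) (hV : ∀ i, hammingDistance (V i) (V' i ∘ σ) ≤ 2 * η)
    (hW : ∀ l, hammingDistance (W l) (W' l ∘ σ) ≤ 2 * η) :
    Close D (permute σ D') (4 * L + 14 * η) := by
  have hs' : (0 : ℝ) < s := by exact_mod_cast hs
  -- Use the center whose index is nearest in the primed sample; each change of rows costs `2 * η`.
  have hgap : ∀ l, gap V (W l) ≤ gap V' (W' l) + 4 * η := fun l => by
    set i := nearest V' (W' l) with hi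
    have h1 := gap_le V (W l) i
    have h2 := hammingDistance_triangle (W l) (W' l ∘ σ) (V i)
    have h3 := hammingDistance_triangle (W' l ∘ σ) (V' i ∘ σ) (V i)
    rw [hammingDistance_comp, hammingDistance_comm (V' i ∘ σ) (V i)] at h3
    have h4 : gap V' (W' l) = hammingDistance (W' l) (V' i) := rfl
    linarith [hV i, hW l]
  have hL' : (∑ l, gap V (W l)) / s ≤ L + 4 * η := by
    rw [div_le_iff₀ hs'] at hL ⊢
    refine (sum_le_sum fun l _ => hgap l).trans ?_
    rw [sum_add_distrib, sum_const, card_univ, Fintype.card_fin, nsmul_eq_mul]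
    linarith
  have h1 := h.close hL'
  have h2 := (h'.close hL).symm.permute σ
  rw [permute_law] at h2
  have h3 : Close (law (unifVec hs) W) (law (unifVec hs) fun l => W' l ∘ σ) (2 * η) := by
    refine (close_law _ _ _).mono ?_
    rw [sum_unifVec_mul, div_le_iff₀ hs']
    refine (sum_le_sum fun l _ => hW l).trans (le_of_eq ?_)
    rw [sum_const, card_univ, Fintype.card_fin, nsmul_eq_mul]
    ring
  exact ((h1.trans h3).trans h2).mono (by linarith)

end Transfer

/-! ### Non-adaptive testers -/

/-- Query the listed bits and decide according to the answers. -/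
def queryAll {m n : ℕ} : List (Fin m × Fin n) → (List Bool → Bool) → QueryTree m n
  | [], F => .verdict (F [])
  | q :: L, F => .query q.1 q.2 fun b => queryAll L fun l => F (b :: l)

theorem run_queryAll {m n : ℕ} (X : Fin m → Cube n) (L : List (Fin m × Fin n))
    (F : List Bool → Bool) : (queryAll L F).run X = F (L.map fun q => X q.1 q.2) := by
  induction L generalizing F with
  | nil => rfl
  | cons q L ih => exact ih _

theorem depth_queryAll {m n : ℕ} (L : List (Fin m × Fin n)) (F : List Bool → Bool) :
    (queryAll L F).depth = L.length := by
  induction L generalizing F with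
  | nil => rfl
  | cons q L ih => simp [queryAll, QueryTree.depth, ih]

/-- The positions of the entries in the columns `J`. -/
def positions (m : ℕ) {n t : ℕ} (J : Fin t → Fin n) : List (Fin m × Fin n) :=
  (univ : Finset (Fin m × Fin t)).toList.map fun q => (q.1, J q.2)

/-- The entries of the matrix `X` in the columns `J`. -/
def answers {m n t : ℕ} (X : Fin m → Cube n) (J : Fin t → Fin n) : List Bool :=
  (positions m J).map fun q => X q.1 q.2

/-- The order of reading does not depend on the columns, so equal answer lists agree entry by entry.
-/
theorem eq_of_answers_eq {m n t : ℕ} {X X' : Fin m → Cube n} {J J' : Fin t → Fin n}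
    (h : answers X J = answers X' J') (i : Fin m) (a : Fin t) : X i (J a) = X' i (J' a) := by
  unfold answers positions at h
  rw [List.map_map, List.map_map] at h
  exact List.map_inj_left.1 h (i, a) (by simp)

/-- The tester that reads the first `m` samples in `t` random columns. -/
def columnTester {n : ℕ} (hn : 0 < n) (m t : ℕ) (F : List Bool → Bool) : Algorithm n where
  samples := m
  Coins := Fin t → Fin n
  coinLaw := ⟨iid (unif n) t, iid_mem (unif_mem hn) t⟩
  strategy J := queryAll (positions m J) F

theorem queryComplexity_columnTester {n : ℕ} (hn : 0 < n) (m t : ℕ) (F : List Bool → Bool) :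
    (columnTester hn m t F).queryComplexity ≤ m * t := by
  refine Finset.sup_le fun J _ => ?_
  change (queryAll (positions m J) F).depth ≤ _
  rw [depth_queryAll]
  simp [positions]

theorem prob_columnTester {n : ℕ} (hn : 0 < n) (m t : ℕ) (F : List Bool → Bool)
    (D : Distribution n) (b : Bool) :
    (columnTester hn m t F).prob D b =
      pr (fun x : (Fin t → Fin n) × (Fin m → Cube n) => iid (unif n) t x.1 * iid D m x.2)
        {x | F (answers x.2 x.1) = b} := by
  change ∑ J : Fin t → Fin n, iid (unif n) t J * ∑ X : Fin m → Cube n,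
    (if (queryAll (positions m J) F).run X = b then iid D m X else 0) = _
  unfold pr
  rw [Fintype.sum_prod_type]
  refine sum_congr rfl fun J _ => ?_
  rw [mul_sum]
  refine sum_congr rfl fun X _ => ?_
  rw [run_queryAll]
  change iid (unif n) t J * (if F (answers X J) = b then iid D m X else 0) = _
  split_ifs with h
  · rw [Set.indicator_of_mem (by exact h)]
  · rw [Set.indicator_of_notMem (by exact h), mul_zero]

theorem prob_true_add_prob_false {n : ℕ} (hn : 0 < n) (m t : ℕ) (F : List Bool → Bool)
    (D : Distribution n) :
    (columnTester hn m t F).prob D true + (columnTester hn m t F).prob D false = 1 := by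
  rw [prob_columnTester, prob_columnTester]
  have h := pr_add_compl (w := fun x : (Fin t → Fin n) × (Fin m → Cube n) =>
    iid (unif n) t x.1 * iid D m x.2) ?_ {x | F (answers x.2 x.1) = true}
  · rw [← h]
    congr 2
    ext x
    simp
  · rw [Fintype.sum_prod_type]
    simp_rw [← mul_sum, (iid_mem (weights_mem D) m).2, mul_one]
    exact (iid_mem (unif_mem hn) t).2

/-! ### The tester: completeness and soundness -/

section Tester

variable {n k s t : ℕ}

/-- The first rows of a sample. -/
def centers (X : Fin (k + 1 + s) → Cube n) : Fin (k + 1) → Cube n := fun i => X (Fin.castAdd s i)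

/-- The remaining rows of a sample. -/
def others (X : Fin (k + 1 + s) → Cube n) : Fin s → Cube n := fun i => X (Fin.natAdd (k + 1) i)

/-- The answers that a member of the property may give. -/
def Acceptable (n k s t : ℕ) (hs : 0 < s) (η L : ℝ) (P : Set (Distribution n)) (l : List Bool) :
    Prop :=
  ∃ D ∈ P, ∃ (X : Fin (k + 1 + s) → Cube n) (J : Fin t → Fin n),
    Represents hs η D (centers X) (others X) ∧
      (∑ l, gap (centers X) (others X l)) / s ≤ L ∧ Representative η X J ∧ answers X J = l

/-- Soundness: the permutation matching the columns is applied to the witnessing member, which stays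
in `P` by index-invariance. -/
theorem Acceptable.exists_close {hs : 0 < s} {η L : ℝ} {P : Set (Distribution n)}
    (hP : IndexInvariant P) {D : Distribution n} {X : Fin (k + 1 + s) → Cube n}
    {J : Fin t → Fin n} (hrep : Represents hs η D (centers X) (others X))
    (hJ : Representative η X J) (h : Acceptable n k s t hs η L P (answers X J)) :
    ∃ D' ∈ P, Close D D' (4 * L + 14 * η) := by
  obtain ⟨D', hD', X', J', hrep', hL, hJ', hans⟩ := h
  obtain ⟨σ, hσ⟩ := hJ.exists_perm hJ' (eq_of_answers_eq hans.symm)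
  exact ⟨permute σ D', (hP D' σ).1 hD',
    close_permute_of_rows hrep hrep' hL σ (fun i => hσ _) fun l => hσ _⟩

theorem not_isFar_of_close {ε : ℝ} {P : Set (Distribution n)} {D D' : Distribution n}
    (hD' : D' ∈ P) (h : Close D D' ε) : ¬ IsFar ε D P :=
  not_lt.2 ((iInf₂_le D' hD').trans (ENNReal.ofReal_le_ofReal h.emd_le))

theorem pr_pair_not_represents_le (hs : 0 < s) {η : ℝ} (hη : 0 < η) (D : Distribution n)
    {u : (Fin t → Fin n) → ℝ} (hu : u ∈ stdSimplex ℝ (Fin t → Fin n)) :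
    pr (fun x : (Fin t → Fin n) × (Fin (k + 1 + s) → Cube n) => u x.1 * iid D (k + 1 + s) x.2)
      {x | ¬ Represents hs η D (centers x.2) (others x.2)} ≤
        (k + 2) / (s * (η / (k + 1)) ^ 2) := by
  refine pr_prod_le_of_left hu _ fun J => ?_
  refine (pr_iid_append D (k + 1) s {x | ¬ Represents hs η D x.1 x.2}).le.trans ?_
  exact pr_prod_le_of_left (iid_mem (weights_mem D) _) _ fun V =>
    pr_not_represents_le hs hη D V

theorem pr_pair_not_sparse_le (hs : 0 < s) (D : Distribution n) (S : Finset (Cube n)) {ζ L : ℝ}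
    (hζ : 0 ≤ ζ) (hL : 0 < L) (hS : ∀ x, D x ≠ 0 → ∃ y ∈ S, hammingDistance x y ≤ ζ)
    {u : (Fin t → Fin n) → ℝ} (hu : u ∈ stdSimplex ℝ (Fin t → Fin n)) :
    pr (fun x : (Fin t → Fin n) × (Fin (k + 1 + s) → Cube n) => u x.1 * iid D (k + 1 + s) x.2)
      {x | L < (∑ l, gap (centers x.2) (others x.2 l)) / s} ≤ (2 * ζ + #S / (k + 1)) / L := by
  refine pr_prod_le_of_left hu _ fun J => ?_
  exact (pr_iid_append D (k + 1) s {x | L < (∑ l, gap x.1 (x.2 l)) / s}).le.trans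
    (pr_not_sparse_le hs D S hζ hL hS)

open Classical in
/-- Index-invariant properties whose members are covered by few balls are testable. -/
theorem columnTester_tests (hn : 0 < n) (hs : 0 < s) (ht : 0 < t) {η L ζ : ℝ} (hη : 0 < η)
    (hL : 0 < L) (hζ : 0 ≤ ζ) {K : ℕ} {P : Set (Distribution n)} (hP : IndexInvariant P)
    (hcov : ∀ D ∈ P, ∃ S : Finset (Cube n), #S ≤ K ∧
      ∀ x, D x ≠ 0 → ∃ y ∈ S, hammingDistance x y ≤ ζ)
    (h1 : ((k : ℝ) + 2) / (s * (η / (k + 1)) ^ 2) ≤ 1 / 9)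
    (h2 : (2 : ℝ) ^ (k + 1 + s) / (t * (η / 2 ^ (k + 1 + s)) ^ 2) ≤ 1 / 9)
    (h3 : (2 * ζ + K / (k + 1)) / L ≤ 1 / 9) :
    (columnTester hn (k + 1 + s) t fun l => decide (Acceptable n k s t hs η L P l)).Tests
      (4 * L + 14 * η) P := by
  have hu := iid_mem (unif_mem hn) t
  have hw : ∀ (D : Distribution n) (x : (Fin t → Fin n) × (Fin (k + 1 + s) → Cube n)),
      0 ≤ iid (unif n) t x.1 * iid D (k + 1 + s) x.2 := fun D x =>
    mul_nonneg (hu.1 _) (iid_nonneg (weights_mem D).1 _ _)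
  have hR : ∀ D : Distribution n,
      pr (fun x : (Fin t → Fin n) × (Fin (k + 1 + s) → Cube n) =>
        iid (unif n) t x.1 * iid D (k + 1 + s) x.2)
        {x | ¬ Representative η x.2 x.1} ≤ 1 / 9 := fun D =>
    pr_prod_le_of_right (iid_mem (weights_mem D) _) _ fun X =>
      (pr_not_representative_le hn ht hη X).trans h2
  have hW : ∀ D : Distribution n, _ := fun D => (pr_pair_not_represents_le (k := k) hs hη D hu).trans h1
  refine ⟨fun D hD => ?_, fun D hfar => ?_⟩
  · obtain ⟨S, hSK, hS⟩ := hcov D hD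
    have hSp := pr_pair_not_sparse_le (k := k) hs D S hζ hL hS hu
    have hSK' : (2 * ζ + (#S : ℝ) / (k + 1)) / L ≤ (2 * ζ + K / (k + 1)) / L := by gcongr
    have hadd := prob_true_add_prob_false hn (k + 1 + s) t
      (fun l => decide (Acceptable n k s t hs η L P l)) D
    have hfalse : (columnTester hn (k + 1 + s) t
        fun l => decide (Acceptable n k s t hs η L P l)).prob D false ≤ 1 / 9 + 1 / 9 + 1 / 9 := by
      rw [prob_columnTester]
      -- Outside three bad events of probability at most `1 / 9`, `D` with its own sample and
      -- columns witnesses acceptability.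
      refine (pr_mono (hw D) ?_).trans ((pr_union_le (hw D) _ _).trans (add_le_add
        ((pr_union_le (hw D) _ _).trans (add_le_add (hW D)
          ((hSp.trans hSK').trans h3))) (hR D)))
      intro x hx
      by_contra hno
      simp only [Set.mem_union, Set.mem_ofPred_eq, not_or, not_not, not_lt] at hno
      exact of_decide_eq_false hx ⟨D, hD, x.2, x.1, hno.1.1, hno.1.2, hno.2, rfl⟩
    linarith
  · have hadd := prob_true_add_prob_false hn (k + 1 + s) t
      (fun l => decide (Acceptable n k s t hs η L P l)) D
    have htrue : (columnTester hn (k + 1 + s) t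
        fun l => decide (Acceptable n k s t hs η L P l)).prob D true ≤ 1 / 9 + 1 / 9 := by
      rw [prob_columnTester]
      -- Two bad events suffice: sparsity comes from the witness.
      refine (pr_mono (hw D) ?_).trans ((pr_union_le (hw D) _ _).trans (add_le_add (hW D) (hR D)))
      intro x hx
      by_contra hno
      simp only [Set.mem_union, Set.mem_ofPred_eq, not_or, not_not] at hno
      obtain ⟨D', hD', hclose⟩ := (of_decide_eq_true hx).exists_close hP hno.1 hno.2
      exact not_isFar_of_close hD' hclose hfar
    linarith

end Tester

/-! ### Dimension zero and the choice of parameters -/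

/-- The algorithm that gives a constant verdict. -/
def constAlgorithm (n : ℕ) (b : Bool) : Algorithm n where
  samples := 0
  Coins := Unit
  coinLaw := ⟨fun _ => 1, by simp [stdSimplex]⟩
  strategy _ := .verdict b

theorem queryComplexity_constAlgorithm (n : ℕ) (b : Bool) :
    (constAlgorithm n b).queryComplexity = 0 :=
  Nat.le_zero.1 (Finset.sup_le fun _ _ => le_rfl)

theorem prob_constAlgorithm (n : ℕ) (b : Bool) (D : Distribution n) :
    (constAlgorithm n b).prob D b = 1 := by
  change ∑ c : Unit, (1 : ℝ) * ∑ V : Fin 0 → Cube n, (if b = b then ∏ i, D (V i) else 0) = 1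
  simp

-- With no columns to sample there is only one distribution, so the property is empty or everything
-- and no query is needed.
open Classical in
theorem constAlgorithm_tests_of_dimension_zero {ε : ℝ} (hε : 0 < ε) (P : Set (Distribution 0)) :
    (constAlgorithm 0 (decide P.Nonempty)).Tests ε P := by
  refine ⟨fun D hD => ?_, fun D hfar => ?_⟩
  · have : decide P.Nonempty = true := decide_eq_true ⟨D, hD⟩
    rw [this, prob_constAlgorithm]
    norm_num
  · have : decide P.Nonempty = false := by
      refine decide_eq_false ?_
      rintro ⟨D', hD'⟩
      have hDD' : D = D' := by
        ext x
        have h1 := sum_weights D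
        have h2 := sum_weights D'
        rw [Fintype.sum_subsingleton _ x] at h1 h2
        exact h1.trans h2.symm
      have h := close_of_totalVariation D D'
      refine not_isFar_of_close hD' (h.mono ?_) hfar
      simpa [hDD'] using hε.le
    rw [this, prob_constAlgorithm]
    norm_num

theorem exists_nat_div_le {a b c : ℝ} (ha : 0 < a) (hb : 0 < b) (hc : 0 < c) :
    ∃ N : ℕ, 0 < N ∧ a / (N * b) ≤ c := by
  obtain ⟨N, hN⟩ := exists_nat_gt (a / (b * c))
  have hN0 : (0 : ℝ) < N := lt_trans (by positivity) hN
  refine ⟨N, by exact_mod_cast hN0, ?_⟩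
  rw [div_lt_iff₀ (by positivity)] at hN
  rw [div_le_iff₀ (by positivity)]
  linarith

/-- Testability with a number of queries that depends only on the VC-dimension and `ε`. -/
theorem exists_tester (d : ℕ) (ε : ℝ) : ∃ Q : ℕ, ∀ (n : ℕ) (P : Set (Distribution n)),
    IndexInvariant P → VCDimAtMost d P → ∃ A : Algorithm n,
      0 < ε → ε < 1 → A.queryComplexity ≤ Q ∧ A.Tests ε P := by
  classical
  by_cases hε : 0 < ε ∧ ε < 1
  swap
  -- Dummy values outside `(0,1)` make the bound and the algorithm total functions of `ε`.
  · exact ⟨0, fun n P _ _ => ⟨constAlgorithm n true, fun h0 h1 => absurd ⟨h0, h1⟩ hε⟩⟩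
  obtain ⟨h0, h1⟩ := hε
  -- With `L = ε / 8` and `η = ε / 28`, `4 * L + 14 * η = ε`. Both `2 * ζ` and `K / (k + 1)` are at
  -- most `ε / 144`, with sum at most `L / 9`. Then `K`, `k`, `s`, `t` are fixed in this order,
  -- independently of `n`.
  obtain ⟨K, hK⟩ := exists_covering_bound d (ζ := ε / 288) (by linarith) (by linarith)
  obtain ⟨k, hk⟩ := exists_nat_gt ((K : ℝ) / (ε / 144))
  obtain ⟨s, hs, hs'⟩ := exists_nat_div_le (a := (k : ℝ) + 2) (b := (ε / 28 / (k + 1)) ^ 2)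
    (c := 1 / 9) (by positivity) (by positivity) (by norm_num)
  obtain ⟨t, ht, ht'⟩ := exists_nat_div_le (a := (2 : ℝ) ^ (k + 1 + s))
    (b := (ε / 28 / 2 ^ (k + 1 + s)) ^ 2) (c := 1 / 9) (by positivity) (by positivity)
    (by norm_num)
  refine ⟨(k + 1 + s) * t, fun n P hP hd => ?_⟩
  rcases Nat.eq_zero_or_pos n with rfl | hn
  · exact ⟨_, fun _ _ => ⟨(queryComplexity_constAlgorithm 0 _).le.trans (Nat.zero_le _),
      constAlgorithm_tests_of_dimension_zero h0 P⟩⟩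
  have hk' : (2 * (ε / 288) + (K : ℝ) / (k + 1)) / (ε / 8) ≤ 1 / 9 := by
    have hkk : (K : ℝ) / (k + 1) ≤ ε / 144 := by
      rw [div_lt_iff₀ (by positivity)] at hk
      rw [div_le_iff₀ (by positivity)]
      nlinarith
    rw [div_le_iff₀ (by positivity)]
    linarith
  have hmain := columnTester_tests (k := k) hn hs ht (η := ε / 28) (L := ε / 8) (ζ := ε / 288)
    (by positivity) (by positivity) (by positivity) hP (fun D hD => hK n D (hd D hD)) hs' ht' hk'
  rw [show 4 * (ε / 8) + 14 * (ε / 28) = ε by ring] at hmain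
  exact ⟨_, fun _ _ => ⟨queryComplexity_columnTester hn (k + 1 + s) t _, hmain⟩⟩

end HugeObject

end

theorem corollary4p2 :
    ∃ q : ℕ → ℝ → ℕ, ∀ (d n : ℕ) (P : Set (HugeObject.Distribution n)),
      IsClosed P → HugeObject.IndexInvariant P → HugeObject.VCDimAtMost d P →
      ∃ A : ℝ → HugeObject.Algorithm n, ∀ ε : ℝ, 0 < ε → ε < 1 →
        (A ε).queryComplexity ≤ q d ε ∧ (A ε).Tests ε P := by
  choose q hq using HugeObject.exists_tester
  refine ⟨q, fun d n P _ hP hd => ?_⟩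
  choose A hA using fun ε => hq d ε n P hP hd
  exact ⟨A, hA⟩
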